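/- Let $\alpha>-1$ and, for $t\in\mathbb{R}$, let $w(x,t)=(1-x^2)^\alpha e^{-tx^2}$, $x\in[-1,1]$. Let $P_n(x,t)$, $n=0,1,2,\dots$, be the monic polynomials of degree $n$ with $\int_{-1}^1 P_m(x,t)P_n(x,t)w(x,t)\,dx=h_n(t)\delta_{mn}$, and let $\beta_n(t)$ be the coefficients of the three-term recurrence $xP_n(x,t)=P_{n+1}(x,t)+\beta_n(t)P_{n-1}(x,t)$, that is, $\beta_0(t)=0$ and $\beta_n(t)=h_n(t)/h_{n-1}(t)$ for $n\ge 1$. For $n\ge 0$ put $$R_n(t)=2n+1+2\alpha-2t\bigl(\beta_n(t)+\beta_{n+1}(t)\bigr),\qquad W_n(t)=1+\frac{2t}{R_n(t)}.$$ Then, for every integer $n\ge 0$, at every real $t\ne 0$ with $R_n(t)\neq 0$ and $W_n(t)\ne 0$, the function $W_n$ is twice continuously differentiable near $t$ and satisfies the Painlevé V equation $$W_n''=\frac{(3W_n-1)(W_n')^2}{2W_n(W_n-1)}-\frac{W_n'}{t}+\frac{(W_n-1)^2}{t^2}\left(\mu_1W_n+\frac{\mu_2}{W_n}\right)+\frac{\mu_3W_n}{t}+\frac{\mu_4W_n(W_n+1)}{W_n-1}$$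 with parameters $$\mu_1=\frac{\alpha^2}{2},\qquad \mu_2=-\frac18,\qquad \mu_3=\frac{2n+1+2\alpha}{2},\qquad \mu_4=-\frac12.$$ Moreover, if $2n+1+2\alpha\ne 0$ (which excludes only the case $n=0$, $\alpha=-\tfrac12$), then $W_n(0)=1$ and $W_n'(0)=\dfrac{2}{2n+1+2\alpha}$. -/

import Mathlib

noncomputable section

namespace SemiclassicalJacobi

open Polynomial MeasureTheory

/-- The symmetric semi-classical Jacobi weight `w(x, t) = (1 - x²)^α e^{-t x²}`, used for
`x ∈ [-1, 1]`. -/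
def weight (α t x : ℝ) : ℝ := (1 - x ^ 2) ^ α * Real.exp (-t * x ^ 2)

/-- The bilinear form `⟨p, q⟩ = ∫_{-1}^{1} p(x) q(x) w(x, t) dx` on real polynomials. -/
def pairing (α t : ℝ) (p q : ℝ[X]) : ℝ :=
  ∫ x in (-1 : ℝ)..1, p.eval x * q.eval x * weight α t x

/-- The monic orthogonal polynomials `P_n(x, t)` for the weight `w(x, t)`, built by Gram-Schmidt
orthogonalization of `1, x, x², …`. See `orthoPoly_monic`, `orthoPoly_natDegree` and
`pairing_orthoPoly` for the defining properties. -/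
def orthoPoly (α t : ℝ) (n : ℕ) : ℝ[X] :=
  X ^ n - ∑ k : Fin n,
    C (pairing α t (X ^ n) (orthoPoly α t k) / pairing α t (orthoPoly α t k) (orthoPoly α t k)) *
      orthoPoly α t k
termination_by n
decreasing_by all_goals exact k.isLt

/-- The squared norms `h_n(t) = ∫_{-1}^{1} P_n(x, t)² w(x, t) dx`. -/
def normSq (α : ℝ) (n : ℕ) (t : ℝ) : ℝ := pairing α t (orthoPoly α t n) (orthoPoly α t n)

/-- The recurrence coefficients: `β_0 = 0` and `β_n(t) = h_n(t) / h_{n-1}(t)` for `n ≥ 1`. They are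
the coefficients in `x P_n = P_{n+1} + β_n P_{n-1}`, see `three_term_recurrence`. -/
def beta (α : ℝ) (n : ℕ) (t : ℝ) : ℝ :=
  match n with
  | 0 => 0
  | k + 1 => normSq α (k + 1) t / normSq α k t

/-- `R_n(t) = 2n + 1 + 2α - 2t (β_n(t) + β_{n+1}(t))`. -/
def R (α : ℝ) (n : ℕ) (t : ℝ) : ℝ :=
  2 * n + 1 + 2 * α - 2 * t * (beta α n t + beta α (n + 1) t)

/-- `W_n(t) = 1 + 2t / R_n(t)`. -/
def W (α : ℝ) (n : ℕ) (t : ℝ) : ℝ := 1 + 2 * t / R α n t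

/-- `y` is twice continuously differentiable near `t` and satisfies at `t` the Painlevé V equation
with parameters `μ₁, μ₂, μ₃, μ₄`. (Meaningful for `t ≠ 0` and `y t ≠ 0, 1`.) -/
def PainleveVAt (μ₁ μ₂ μ₃ μ₄ : ℝ) (y : ℝ → ℝ) (t : ℝ) : Prop :=
  ContDiffAt ℝ 2 y t ∧
  deriv (deriv y) t =
    (3 * y t - 1) * (deriv y t) ^ 2 / (2 * y t * (y t - 1)) - deriv y t / t
      + (y t - 1) ^ 2 / t ^ 2 * (μ₁ * y t + μ₂ / y t)
      + μ₃ * y t / t + μ₄ * y t * (y t + 1) / (y t - 1)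

/-! Proofs that the objects above are the monic orthogonal polynomials and their recurrence
coefficients. -/

theorem weight_intervalIntegrable {α : ℝ} (hα : -1 < α) (t : ℝ) {g : ℝ → ℝ} (hg : Continuous g) :
    IntervalIntegrable (fun x => g x * weight α t x) volume (-1) 1 := by
  have key : ∀ {g : ℝ → ℝ}, Continuous g →
      IntervalIntegrable (fun x => g x * weight α t x) volume 0 1 := by
    intro g hg
    have h1 : IntervalIntegrable (fun x : ℝ => (1 - x) ^ α) volume 0 1 := by
      have := (intervalIntegral.intervalIntegrable_rpow' (a := 0) (b := 1) hα).comp_sub_left 1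
      simpa using this.symm
    have h2 : ContinuousOn (fun x : ℝ => g x * Real.exp (-t * x ^ 2) * (1 + x) ^ α)
        (Set.uIcc 0 1) := by
      refine ContinuousOn.mul (by fun_prop) ?_
      refine ContinuousOn.rpow_const (by fun_prop) ?_
      intro x hx
      rw [Set.uIcc_of_le zero_le_one] at hx
      left
      linarith [hx.1]
    have h3 := h1.mul_continuousOn h2
    refine h3.congr ?_
    intro x hx
    rw [Set.uIoc_of_le zero_le_one] at hx
    have e : (1 - x ^ 2 : ℝ) = (1 - x) * (1 + x) := by ring
    simp only [weight]
    rw [e, Real.mul_rpow (by linarith [hx.2]) (by linarith [hx.1])]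
    ring
  have hneg : IntervalIntegrable (fun x => g x * weight α t x) volume (-1) 0 := by
    have h := (key (g := fun x => g (-x)) (by fun_prop)).comp_sub_left 0
    have h' := h.symm
    simpa [weight] using h'
  exact hneg.trans (key hg)

theorem pairing_intervalIntegrable {α : ℝ} (hα : -1 < α) (t : ℝ) (p q : ℝ[X]) :
    IntervalIntegrable (fun x => p.eval x * q.eval x * weight α t x) volume (-1) 1 :=
  weight_intervalIntegrable hα t (by fun_prop)

theorem pairing_comm (α t : ℝ) (p q : ℝ[X]) : pairing α t p q = pairing α t q p := by
  simp only [pairing, mul_comm (p.eval _)]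

theorem pairing_X_mul (α t : ℝ) (p q : ℝ[X]) :
    pairing α t (X * p) q = pairing α t p (X * q) := by
  simp only [pairing, eval_mul, eval_X]
  congr 1
  ext x
  ring

theorem pairing_add_left {α : ℝ} (hα : -1 < α) (t : ℝ) (p q r : ℝ[X]) :
    pairing α t (p + q) r = pairing α t p r + pairing α t q r := by
  simp only [pairing]
  rw [← intervalIntegral.integral_add (pairing_intervalIntegrable hα t p r)
    (pairing_intervalIntegrable hα t q r)]
  congr 1
  ext x
  rw [eval_add]
  ring

theorem pairing_C_mul_left (α t c : ℝ) (p q : ℝ[X]) :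
    pairing α t (C c * p) q = c * pairing α t p q := by
  simp only [pairing]
  rw [← intervalIntegral.integral_const_mul]
  congr 1
  ext x
  rw [eval_mul, eval_C]
  ring

theorem pairing_sub_left {α : ℝ} (hα : -1 < α) (t : ℝ) (p q r : ℝ[X]) :
    pairing α t (p - q) r = pairing α t p r - pairing α t q r := by
  have h : p - q = p + C (-1) * q := by simp [sub_eq_add_neg]
  rw [h, pairing_add_left hα, pairing_C_mul_left]
  ring

theorem pairing_sum_left {α : ℝ} (hα : -1 < α) (t : ℝ) {ι : Type*} (s : Finset ι) (f : ι → ℝ[X])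
    (r : ℝ[X]) : pairing α t (∑ i ∈ s, f i) r = ∑ i ∈ s, pairing α t (f i) r := by
  classical
  induction s using Finset.induction_on with
  | empty => simp [pairing]
  | insert a s ha ih => rw [Finset.sum_insert ha, Finset.sum_insert ha, pairing_add_left hα, ih]

theorem pairing_self_pos {α : ℝ} (hα : -1 < α) (t : ℝ) {p : ℝ[X]} (hp : p ≠ 0) :
    0 < pairing α t p p := by
  have hnn : ∀ x ∈ Set.Ioc (-1 : ℝ) 1, 0 ≤ p.eval x * p.eval x * weight α t x := by
    intro x hx
    have : 0 ≤ 1 - x ^ 2 := by nlinarith [hx.1, hx.2]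
    exact mul_nonneg (mul_self_nonneg _) (mul_nonneg (Real.rpow_nonneg this _) (Real.exp_pos _).le)
  rw [pairing, intervalIntegral.integral_pos_iff_support_of_nonneg_ae' ?_
    (pairing_intervalIntegrable hα t p p)]
  · refine ⟨by norm_num, ?_⟩
    have hsub : Set.Ioo (-1 : ℝ) 1 \ (p.roots.toFinset : Set ℝ) ⊆
        Function.support (fun x => p.eval x * p.eval x * weight α t x) ∩ Set.Ioc (-1) 1 := by
      rintro x ⟨hx, hr⟩
      refine ⟨?_, hx.1, hx.2.le⟩
      have h0 : p.eval x ≠ 0 := by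
        intro h
        apply hr
        simp [hp, h]
      have h1 : 0 < 1 - x ^ 2 := by nlinarith [hx.1, hx.2]
      exact mul_ne_zero (mul_ne_zero h0 h0)
        (mul_pos (Real.rpow_pos_of_pos h1 _) (Real.exp_pos _)).ne'
    refine lt_of_lt_of_le ?_ (measure_mono hsub)
    rw [measure_sdiff_null (Finset.measure_zero _ _)]
    simp
  · rw [Set.uIoc_of_le (by norm_num)]
    filter_upwards [ae_restrict_mem measurableSet_Ioc] with x hx
    exact hnn x hx

theorem orthoPoly_monic_natDegree (α t : ℝ) (n : ℕ) :
    (orthoPoly α t n).Monic ∧ (orthoPoly α t n).natDegree = n := by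
  induction n using Nat.strong_induction_on with
  | _ n ih =>
    have hdeg : (∑ k : Fin n, C (pairing α t (X ^ n) (orthoPoly α t k) /
        pairing α t (orthoPoly α t k) (orthoPoly α t k)) * orthoPoly α t k).degree <
        (n : WithBot ℕ) := by
      refine (degree_sum_le _ _).trans_lt ?_
      refine (Finset.sup_lt_iff (WithBot.bot_lt_coe n)).2 ?_
      intro k _
      refine lt_of_le_of_lt (b := (orthoPoly α t k).degree) ?_ ?_
      · rw [← smul_eq_C_mul]
        exact degree_smul_le _ _
      refine degree_le_natDegree.trans_lt ?_
      rw [(ih k k.isLt).2]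
      exact WithBot.coe_lt_coe.2 k.isLt
    rw [orthoPoly]
    refine ⟨monic_X_pow_sub hdeg, ?_⟩
    apply natDegree_eq_of_degree_eq_some
    rw [degree_sub_eq_left_of_degree_lt (by simpa using hdeg), degree_X_pow]

/-- `P_n` is monic. -/
theorem orthoPoly_monic (α t : ℝ) (n : ℕ) : (orthoPoly α t n).Monic :=
  (orthoPoly_monic_natDegree α t n).1

/-- `P_n` has degree `n`. -/
theorem orthoPoly_natDegree (α t : ℝ) (n : ℕ) : (orthoPoly α t n).natDegree = n :=
  (orthoPoly_monic_natDegree α t n).2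

theorem normSq_pos {α : ℝ} (hα : -1 < α) (n : ℕ) (t : ℝ) : 0 < normSq α n t :=
  pairing_self_pos hα t (orthoPoly_monic α t n).ne_zero

theorem pairing_orthoPoly_of_lt {α : ℝ} (hα : -1 < α) (t : ℝ) (n : ℕ) :
    ∀ m < n, pairing α t (orthoPoly α t n) (orthoPoly α t m) = 0 := by
  induction n using Nat.strong_induction_on with
  | _ n ih =>
    intro m hm
    rw [orthoPoly, pairing_sub_left hα, pairing_sum_left hα, Finset.sum_eq_single ⟨m, hm⟩]
    · rw [pairing_C_mul_left]
      have h := (normSq_pos hα m t).ne'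
      simp only [normSq] at h
      simp only [div_mul_cancel₀ _ h, sub_self]
    · intro k _ hk
      rw [pairing_C_mul_left]
      have hne : (k : ℕ) ≠ m := fun h => hk (Fin.ext h)
      rcases lt_or_gt_of_ne hne with h | h
      · rw [pairing_comm α t (orthoPoly α t k) (orthoPoly α t m), ih m hm k h, mul_zero]
      · rw [ih k k.isLt m h, mul_zero]
    · intro h
      exact absurd (Finset.mem_univ _) h

/-- The orthogonality relation `∫ P_m P_n w = h_n δ_{mn}`. -/
theorem pairing_orthoPoly {α : ℝ} (hα : -1 < α) (t : ℝ) (m n : ℕ) :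
    pairing α t (orthoPoly α t m) (orthoPoly α t n) = if m = n then normSq α n t else 0 := by
  rcases lt_trichotomy m n with h | h | h
  · rw [if_neg h.ne, pairing_comm, pairing_orthoPoly_of_lt hα t n m h]
  · subst h
    simp [normSq]
  · rw [if_neg h.ne', pairing_orthoPoly_of_lt hα t m n h]

theorem pairing_orthoPoly_of_degree_lt {α : ℝ} (hα : -1 < α) (t : ℝ) {n : ℕ} {q : ℝ[X]}
    (hq : q.degree < n) : pairing α t q (orthoPoly α t n) = 0 := by
  have hX : ∀ m < n, pairing α t (X ^ m) (orthoPoly α t n) = 0 := by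
    intro m hm
    have h := pairing_orthoPoly_of_lt hα t n m hm
    rw [pairing_comm] at h
    rw [orthoPoly, pairing_sub_left hα, pairing_sum_left hα, Finset.sum_eq_zero, sub_zero] at h
    · exact h
    · intro k _
      rw [pairing_C_mul_left, pairing_comm α t (orthoPoly α t k) (orthoPoly α t n),
        pairing_orthoPoly_of_lt hα t n k (k.isLt.trans hm), mul_zero]
  rw [q.as_sum_range_C_mul_X_pow, pairing_sum_left hα]
  refine Finset.sum_eq_zero fun i hi => ?_
  rw [pairing_C_mul_left]
  by_cases h0 : q.coeff i = 0
  · rw [h0, zero_mul]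
  · rw [hX i, mul_zero]
    exact_mod_cast (le_degree_of_ne_zero h0).trans_lt hq

theorem pairing_comp_neg (α t : ℝ) (p q : ℝ[X]) :
    pairing α t (p.comp (-X)) (q.comp (-X)) = pairing α t p q := by
  have h := intervalIntegral.integral_comp_neg (a := -1) (b := 1)
    (fun x => p.eval x * q.eval x * weight α t x)
  simp only [neg_neg] at h
  simp only [pairing]
  rw [← h]
  simp [eval_comp, weight]

/-- The parity `P_n(-x) = (-1)^n P_n(x)`. -/
theorem orthoPoly_comp_neg (α t : ℝ) (n : ℕ) :
    (orthoPoly α t n).comp (-X) = C ((-1) ^ n) * orthoPoly α t n := by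
  induction n using Nat.strong_induction_on with
  | _ n ih =>
    have hs : ((-1 : ℝ) ^ n) * (-1) ^ n = 1 := by rw [← mul_pow]; simp
    have hc : ∀ k : Fin n, pairing α t (X ^ n) (orthoPoly α t k) =
        (-1) ^ n * (-1) ^ (k : ℕ) * pairing α t (X ^ n) (orthoPoly α t k) := by
      intro k
      conv_lhs => rw [← pairing_comp_neg, ih k k.isLt]
      have e : ((X : ℝ[X]) ^ n).comp (-X) = C ((-1) ^ n) * X ^ n := by
        rw [X_pow_comp, neg_pow]
        simp
      rw [e, pairing_C_mul_left, pairing_comm, pairing_C_mul_left, pairing_comm]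
      ring
    conv_lhs => rw [orthoPoly]
    conv_rhs => rw [orthoPoly]
    rw [sub_comp, mul_sub, X_pow_comp, neg_pow, Polynomial.sum_comp, Finset.mul_sum]
    congr 1
    · simp
    · refine Finset.sum_congr rfl fun k _ => ?_
      rw [mul_comp, C_comp, ih k k.isLt, ← mul_assoc, ← mul_assoc, ← C_mul, ← C_mul]
      congr 2
      conv_lhs => rw [hc k]
      have hk : ((-1 : ℝ) ^ (k : ℕ)) * (-1) ^ (k : ℕ) = 1 := by rw [← mul_pow]; simp
      linear_combination ((-1 : ℝ) ^ n * pairing α t (X ^ n) (orthoPoly α t k) /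
        pairing α t (orthoPoly α t k) (orthoPoly α t k)) * hk

theorem eq_zero_of_pairing_orthoPoly {α : ℝ} (hα : -1 < α) (t : ℝ) {q : ℝ[X]}
    (h : ∀ k ≤ q.natDegree, pairing α t q (orthoPoly α t k) = 0) : q = 0 := by
  by_contra hq
  have hP := orthoPoly_monic_natDegree α t q.natDegree
  have ha : q.leadingCoeff ≠ 0 := leadingCoeff_ne_zero.2 hq
  have hlt : (q - C q.leadingCoeff * orthoPoly α t q.natDegree).degree < q.natDegree := by
    rw [← degree_eq_natDegree hq]
    refine degree_sub_lt_left ?_ hq ?_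
    · rw [degree_C_mul ha, degree_eq_natDegree hP.1.ne_zero, hP.2, degree_eq_natDegree hq]
    · rw [leadingCoeff_mul, leadingCoeff_C, hP.1.leadingCoeff, mul_one]
  have h1 := pairing_orthoPoly_of_degree_lt hα t hlt
  rw [pairing_sub_left hα, h _ le_rfl, pairing_C_mul_left, zero_sub, neg_eq_zero] at h1
  exact mul_ne_zero ha (normSq_pos hα q.natDegree t).ne' h1

theorem pairing_X_mul_self (α t : ℝ) (n : ℕ) :
    pairing α t (X * orthoPoly α t n) (orthoPoly α t n) = 0 := by
  have h := pairing_comp_neg α t (X * orthoPoly α t n) (orthoPoly α t n)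
  have e : -X * (C ((-1) ^ n) * orthoPoly α t n) =
      C (-(-1) ^ n) * (X * orthoPoly α t n) := by
    rw [C_neg]
    ring
  rw [mul_comp, X_comp, orthoPoly_comp_neg, e, pairing_C_mul_left, pairing_comm,
    pairing_C_mul_left, pairing_comm] at h
  have hs : ((-1 : ℝ) ^ n) * (-1) ^ n = 1 := by rw [← mul_pow]; simp
  linear_combination (-1 / 2 : ℝ) * h -
    (1 / 2) * pairing α t (X * orthoPoly α t n) (orthoPoly α t n) * hs

theorem degree_X_mul_sub_lt (α t : ℝ) (n : ℕ) :
    (X * orthoPoly α t n - orthoPoly α t (n + 1)).degree < ((n + 1 : ℕ) : WithBot ℕ) := by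
  have h0 := orthoPoly_monic_natDegree α t n
  have h1 := orthoPoly_monic_natDegree α t (n + 1)
  have hd : (X * orthoPoly α t n).degree = ((n + 1 : ℕ) : WithBot ℕ) := by
    rw [degree_mul, degree_X, degree_eq_natDegree h0.1.ne_zero, h0.2]
    push_cast
    ring
  rw [← hd]
  refine degree_sub_lt_left ?_ (mul_ne_zero X_ne_zero h0.1.ne_zero) ?_
  · rw [hd, degree_eq_natDegree h1.1.ne_zero, h1.2]
  · rw [leadingCoeff_mul, leadingCoeff_X, h0.1.leadingCoeff, h1.1.leadingCoeff, mul_one]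

theorem natDegree_X_mul_sub_le (α t : ℝ) (n : ℕ) :
    (X * orthoPoly α t n - orthoPoly α t (n + 1)).natDegree ≤ n := by
  by_cases h : X * orthoPoly α t n - orthoPoly α t (n + 1) = 0
  · simp [h]
  · exact Nat.lt_succ_iff.1 ((natDegree_lt_iff_degree_lt h).2 (degree_X_mul_sub_lt α t n))

/-- The three-term recurrence `x P_0 = P_1` and `x P_n = P_{n+1} + β_n P_{n-1}` for `n ≥ 1`. -/
theorem three_term_recurrence {α : ℝ} (hα : -1 < α) (t : ℝ) :
    X * orthoPoly α t 0 = orthoPoly α t 1 ∧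
    ∀ n : ℕ, X * orthoPoly α t (n + 1) =
      orthoPoly α t (n + 2) + C (beta α (n + 1) t) * orthoPoly α t n := by
  constructor
  · rw [← sub_eq_zero]
    have hd : (X * orthoPoly α t 0 - orthoPoly α t 1).natDegree ≤ 0 :=
      natDegree_X_mul_sub_le α t 0
    refine eq_zero_of_pairing_orthoPoly hα t fun k hk => ?_
    obtain rfl : k = 0 := by omega
    rw [pairing_sub_left hα, pairing_X_mul_self, pairing_orthoPoly hα]
    simp
  · intro n
    rw [← sub_eq_zero, ← sub_sub]
    have hd : (X * orthoPoly α t (n + 1) - orthoPoly α t (n + 2) -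
        C (beta α (n + 1) t) * orthoPoly α t n).natDegree ≤ n + 1 := by
      refine (natDegree_sub_le _ _).trans (max_le ?_ ?_)
      · exact natDegree_X_mul_sub_le α t (n + 1)
      · refine (natDegree_C_mul_le _ _).trans ?_
        rw [orthoPoly_natDegree]
        omega
    have hX : ∀ k, (X * orthoPoly α t k).degree = ((k + 1 : ℕ) : WithBot ℕ) := by
      intro k
      have h0 := orthoPoly_monic_natDegree α t k
      rw [degree_mul, degree_X, degree_eq_natDegree h0.1.ne_zero, h0.2]
      push_cast
      ring
    refine eq_zero_of_pairing_orthoPoly hα t fun k hk => ?_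
    have hk' := hk.trans hd
    rw [pairing_sub_left hα, pairing_sub_left hα, pairing_C_mul_left, pairing_orthoPoly hα,
      pairing_orthoPoly hα, if_neg (by omega), sub_zero]
    rcases Nat.lt_or_ge n k with h | h
    · obtain rfl : k = n + 1 := by omega
      rw [pairing_X_mul_self, if_neg (by omega)]
      simp
    · rw [pairing_X_mul, pairing_comm]
      rcases h.lt_or_eq with h' | rfl
      · rw [pairing_orthoPoly_of_degree_lt hα t, if_neg (by omega)]
        · simp
        · rw [hX]
          exact_mod_cast Nat.succ_lt_succ h'
      · have e : pairing α t (X * orthoPoly α t k) (orthoPoly α t (k + 1)) =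
            normSq α (k + 1) t := by
          have h1 := pairing_orthoPoly_of_degree_lt hα t (degree_X_mul_sub_lt α t k)
          rw [pairing_sub_left hα, sub_eq_zero] at h1
          rw [h1, normSq]
        rw [e, if_pos rfl, beta, div_mul_cancel₀ _ (normSq_pos hα k t).ne', sub_self]

end SemiclassicalJacobi

end

/-!
`W_n` solves Painlevé V because `β_n` and `R_n` satisfy a closed first-order system in `t`.

Differentiating the orthogonality relations in `t` gives the Volterra lattice equation
`β_n' = β_n (β_{n-1} - β_{n+1})` (`hasDerivAt_beta`), which also shows that every `β_n` is smooth.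

To close the system for fixed `n`, the neighbouring coefficients have to be eliminated. Integration by
parts yields the structure relation
`(1 - x²) P_n' = (2 t β_n - n) x P_n + β_n (R_n + 2 t (1 - x²)) P_{n-1}` (`structure_relation`).
At `x = 1` the left-hand side vanishes. Together with the three-term recurrence, the relations for `n`
and `n - 1` form a homogeneous linear system for the nonzero vector `(P_n(1), P_{n-1}(1))`, and its
determinant gives `β_n R_n R_{n-1} = (n - 2 t β_n) (n + 2 α - 2 t β_n)` (`beta_mul_R_mul_R`).

This relation, for `n` and for `n + 1`, turns the Volterra equations into first-order equations for
`R_n` and `β_n` alone. With `W = 1 + 2 t / R_n` and `u = 2 t β_n - n - α` they read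
`t W' = (W - 1) (1/2 + W u) + t W` and `t u' = (u + n + α) t / (W - 1) - (W - 1) (u² - α²) / 2`
(`hasDerivAt_W`, `hasDerivAt_two_mul_t_mul_beta`). Differentiating the first equation and eliminating
`u` is a rational identity (`painleveV_identity`). The values at `t = 0` follow from
`R_n(0) = 2 n + 1 + 2 α`.
-/

namespace SemiclassicalJacobi

open Polynomial MeasureTheory

/-! ### The bilinear form -/

theorem pairing_X_pow_mul (α t : ℝ) (k : ℕ) (p q : ℝ[X]) :
    pairing α t (X ^ k * p) q = pairing α t p (X ^ k * q) := by
  induction k generalizing q with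
  | zero => simp
  | succ k ih => rw [pow_succ', mul_assoc, pairing_X_mul, ih, ← mul_assoc, ← pow_succ,
    pow_succ']

theorem pairing_C_mul_right (α t c : ℝ) (p q : ℝ[X]) :
    pairing α t p (C c * q) = c * pairing α t p q := by
  simp only [pairing_comm α t p, pairing_C_mul_left]

theorem coeff_orthoPoly_self (α t : ℝ) (n : ℕ) : (orthoPoly α t n).coeff n = 1 := by
  have h := (orthoPoly_monic α t n).coeff_natDegree
  rwa [orthoPoly_natDegree] at h

/-- Orthogonality to lower degrees in quantitative form: pairing with `P_n` reads off the
coefficient of `x^n`. -/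
theorem pairing_orthoPoly_of_natDegree_le {α : ℝ} (hα : -1 < α) (t : ℝ) (q : ℝ[X]) {n : ℕ}
    (hq : q.natDegree ≤ n) : pairing α t q (orthoPoly α t n) = q.coeff n * normSq α n t := by
  have h := orthoPoly_natDegree α t n
  have hlt : (q - C (q.coeff n) * orthoPoly α t n).degree < (n : WithBot ℕ) := by
    rw [degree_lt_iff_coeff_zero]
    intro m hm
    rw [coeff_sub, coeff_C_mul]
    rcases hm.eq_or_lt with rfl | hm
    · rw [coeff_orthoPoly_self, mul_one, sub_self]
    · rw [coeff_eq_zero_of_natDegree_lt (hq.trans_lt hm),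
        coeff_eq_zero_of_natDegree_lt (h.trans_lt hm), mul_zero, sub_zero]
  have h1 := pairing_orthoPoly_of_degree_lt hα t hlt
  rw [pairing_sub_left hα, pairing_C_mul_left, sub_eq_zero] at h1
  rw [h1, normSq]

/-! ### Evolution of the recurrence coefficients in the parameter -/

/-- Since `∂w/∂s = -x² w`, the pairing of two fixed polynomials is differentiable in the parameter
of the weight. -/
theorem hasDerivAt_pairing {α : ℝ} (hα : -1 < α) (p q : ℝ[X]) (t : ℝ) :
    HasDerivAt (fun s => pairing α s p q) (-pairing α t (X ^ 2 * p) q) t := by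
  have hmeas : ∀ (s : ℝ) (g : ℝ → ℝ), Continuous g →
      AEStronglyMeasurable (fun x => g x * weight α s x) (volume.restrict (Set.uIoc (-1) 1)) := by
    intro s g hg
    rw [Set.uIoc_of_le (by norm_num)]
    exact (weight_intervalIntegrable hα s hg).1.aestronglyMeasurable
  have hbound := weight_intervalIntegrable hα 0
    (g := fun x => |x ^ 2 * p.eval x * q.eval x| * Real.exp (|t| + 1)) (by fun_prop)
  have key := intervalIntegral.hasDerivAt_integral_of_dominated_loc_of_deriv_le
    (μ := volume) (a := -1) (b := 1) (x₀ := t) (s := Metric.ball t 1)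
    (F := fun s x => p.eval x * q.eval x * weight α s x)
    (F' := fun s x => (-(x ^ 2 * p.eval x * q.eval x)) * weight α s x)
    (bound := fun x => |x ^ 2 * p.eval x * q.eval x| * Real.exp (|t| + 1) * weight α 0 x)
    (Metric.ball_mem_nhds t one_pos)
    (Filter.Eventually.of_forall fun s => hmeas s _ (by fun_prop))
    (pairing_intervalIntegrable hα t p q) (hmeas t _ (by fun_prop)) ?_ hbound ?_
  · refine key.2.congr_deriv ?_
    rw [pairing, ← intervalIntegral.integral_neg]
    congr 1
    ext x
    simp only [eval_mul, eval_pow, eval_X]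
    ring
  -- for `|s - t| < 1` and `x² ≤ 1` the exponential factor is at most `exp (|t| + 1)`
  · refine Filter.Eventually.of_forall fun x hx s hs => ?_
    rw [Set.uIoc_of_le (by norm_num)] at hx
    have h0 : 0 ≤ 1 - x ^ 2 := by nlinarith [hx.1, hx.2]
    have hs' : |s| ≤ |t| + 1 := by
      rw [Metric.mem_ball, Real.dist_eq] at hs
      have h1 : |s| - |t| ≤ |s - t| := abs_sub_abs_le_abs_sub s t
      linarith
    have hexp : Real.exp (-s * x ^ 2) ≤ Real.exp (|t| + 1) := by
      refine Real.exp_le_exp.2 ?_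
      have h1 : -s * x ^ 2 ≤ |s| * x ^ 2 :=
        mul_le_mul_of_nonneg_right (neg_le_abs s) (sq_nonneg x)
      nlinarith [abs_nonneg s]
    have hr := Real.rpow_nonneg h0 α
    rw [norm_mul, norm_neg, Real.norm_eq_abs, Real.norm_eq_abs,
      mul_assoc |x ^ 2 * p.eval x * q.eval x|]
    refine mul_le_mul_of_nonneg_left ?_ (abs_nonneg _)
    rw [weight, weight, abs_of_nonneg (mul_nonneg hr (Real.exp_pos _).le)]
    simp only [neg_zero, zero_mul, Real.exp_zero, mul_one]
    rw [mul_comm]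
    exact mul_le_mul_of_nonneg_right hexp hr
  · refine Filter.Eventually.of_forall fun x _ s _ => ?_
    have h1 : HasDerivAt (fun s : ℝ => -s * x ^ 2) (-1 * x ^ 2) s :=
      ((hasDerivAt_id s).neg).mul_const _
    have h2 := (h1.exp.const_mul ((1 - x ^ 2) ^ α)).const_mul (p.eval x * q.eval x)
    refine h2.congr_deriv ?_
    simp only [weight]
    ring

theorem pairing_orthoPoly_left_eq_sum {α : ℝ} (hα : -1 < α) (t s : ℝ) (n : ℕ) (q : ℝ[X]) :
    pairing α s (orthoPoly α t n) q =
      ∑ i ∈ Finset.range (n + 1), (orthoPoly α t n).coeff i * pairing α s (X ^ i) q := by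
  conv_lhs => rw [(orthoPoly α t n).as_sum_range_C_mul_X_pow, orthoPoly_natDegree,
    pairing_sum_left hα]
  simp only [pairing_C_mul_left]

/-- The coefficients of `P_n` depend differentiably on `t`, because Gram-Schmidt expresses them
rationally through pairings of monomials with earlier `P_k`. -/
theorem differentiable_coeff_orthoPoly {α : ℝ} (hα : -1 < α) (n i : ℕ) :
    Differentiable ℝ (fun t => (orthoPoly α t n).coeff i) := by
  induction n using Nat.strong_induction_on generalizing i with
  | _ n ih =>
    have hpair : ∀ k < n, ∀ m, Differentiable ℝ
        (fun t => pairing α t (X ^ m) (orthoPoly α t k)) := by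
      intro k hk m
      have e : (fun t => pairing α t (X ^ m) (orthoPoly α t k)) = fun t =>
          ∑ i ∈ Finset.range (k + 1), (orthoPoly α t k).coeff i * pairing α t (X ^ i) (X ^ m) := by
        ext t
        rw [pairing_comm, pairing_orthoPoly_left_eq_sum hα]
      rw [e]
      refine Differentiable.fun_sum fun i _ => (ih k hk i).mul fun t => ?_
      exact (hasDerivAt_pairing hα _ _ t).differentiableAt
    have hnorm : ∀ t k, pairing α t (orthoPoly α t k) (orthoPoly α t k) =
        pairing α t (X ^ k) (orthoPoly α t k) := by
      intro t k
      rw [pairing_orthoPoly_of_natDegree_le hα t (X ^ k) (natDegree_X_pow k).le, coeff_X_pow_self,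
        one_mul, normSq]
    have e : (fun t => (orthoPoly α t n).coeff i) = fun t => (X ^ n : ℝ[X]).coeff i -
        ∑ k : Fin n, pairing α t (X ^ n) (orthoPoly α t k) /
          pairing α t (X ^ (k : ℕ)) (orthoPoly α t k) * (orthoPoly α t k).coeff i := by
      ext t
      rw [orthoPoly, coeff_sub, finsetSum_coeff]
      simp only [coeff_C_mul, hnorm]
    rw [e]
    refine (differentiable_const _).sub (Differentiable.fun_sum fun k _ => ?_)
    refine ((hpair k k.isLt n).div (hpair k k.isLt k) fun t => ?_).mul (ih k k.isLt i)
    rw [← hnorm]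
    exact (normSq_pos hα k t).ne'

/-- `h_n' = -⟨x² P_n, P_n⟩`: the change of `P_n` with `t` has degree less than `n` and does not
contribute. -/
theorem hasDerivAt_normSq {α : ℝ} (hα : -1 < α) (n : ℕ) (t : ℝ) :
    HasDerivAt (normSq α n) (-pairing α t (X ^ 2 * orthoPoly α t n) (orthoPoly α t n)) t := by
  -- `h_n(s) = ⟨P_n(s), P_n(t)⟩_s`, both factors being monic of degree `n`; the second one is fixed
  have e : normSq α n = fun s => ∑ i ∈ Finset.range (n + 1),
      (orthoPoly α s n).coeff i * pairing α s (X ^ i) (orthoPoly α t n) := by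
    ext s
    rw [← pairing_orthoPoly_left_eq_sum hα, pairing_comm,
      pairing_orthoPoly_of_natDegree_le hα s _ (orthoPoly_natDegree α t n).le,
      coeff_orthoPoly_self, one_mul]
  rw [e]
  refine (HasDerivAt.fun_sum fun i _ =>
    ((differentiable_coeff_orthoPoly hα n i t).hasDerivAt).mul
      (hasDerivAt_pairing hα (X ^ i) (orthoPoly α t n) t)).congr_deriv ?_
  rw [Finset.sum_add_distrib, Finset.sum_eq_zero, zero_add]
  · rw [pairing_X_pow_mul, pairing_orthoPoly_left_eq_sum hα, ← Finset.sum_neg_distrib]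
    refine Finset.sum_congr rfl fun i _ => ?_
    rw [pairing_X_pow_mul, mul_neg]
  · intro i hi
    rcases (Nat.lt_succ_iff.1 (Finset.mem_range.1 hi)).eq_or_lt with rfl | hi'
    · simp only [coeff_orthoPoly_self, deriv_const, zero_mul]
    · rw [pairing_orthoPoly_of_degree_lt hα t (by rw [degree_X_pow]; exact_mod_cast hi'), mul_zero]

/-- The three-term recurrence for all `n` at once: at `n = 0` the truncated index `n - 1` is harmless
because `β_0 = 0`. -/
theorem X_mul_orthoPoly {α : ℝ} (hα : -1 < α) (t : ℝ) (n : ℕ) :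
    X * orthoPoly α t n = orthoPoly α t (n + 1) + C (beta α n t) * orthoPoly α t (n - 1) := by
  cases n with
  | zero => simpa [beta] using (three_term_recurrence hα t).1
  | succ m => exact (three_term_recurrence hα t).2 m

theorem normSq_succ {α : ℝ} (hα : -1 < α) (n : ℕ) (t : ℝ) :
    normSq α (n + 1) t = beta α (n + 1) t * normSq α n t := by
  rw [beta, div_mul_cancel₀ _ (normSq_pos hα n t).ne']

theorem beta_succ_pos {α : ℝ} (hα : -1 < α) (n : ℕ) (t : ℝ) : 0 < beta α (n + 1) t :=
  div_pos (normSq_pos hα (n + 1) t) (normSq_pos hα n t)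

theorem natDegree_X_pow_mul_orthoPoly_le (α t : ℝ) (k n : ℕ) :
    (X ^ k * orthoPoly α t n).natDegree ≤ n + k := by
  refine natDegree_mul_le.trans ?_
  rw [natDegree_X_pow, orthoPoly_natDegree, add_comm]

theorem natDegree_X_mul_orthoPoly_le (α t : ℝ) (n : ℕ) :
    (X * orthoPoly α t n).natDegree ≤ n + 1 := by
  simpa using natDegree_X_pow_mul_orthoPoly_le α t 1 n

theorem pairing_X_mul_orthoPoly_succ {α : ℝ} (hα : -1 < α) (t : ℝ) (n : ℕ) :
    pairing α t (X * orthoPoly α t n) (orthoPoly α t (n + 1)) = normSq α (n + 1) t := by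
  rw [pairing_orthoPoly_of_natDegree_le hα, coeff_X_mul, coeff_orthoPoly_self, one_mul]
  exact natDegree_X_mul_orthoPoly_le α t n

theorem pairing_X_sq_mul_orthoPoly_self {α : ℝ} (hα : -1 < α) (t : ℝ) (n : ℕ) :
    pairing α t (X ^ 2 * orthoPoly α t n) (orthoPoly α t n) =
      (beta α n t + beta α (n + 1) t) * normSq α n t := by
  rw [pow_two, mul_assoc, pairing_X_mul]
  conv_lhs => rw [X_mul_orthoPoly hα t n, pairing_add_left hα, pairing_C_mul_left,
    ← X_mul_orthoPoly hα t n, pairing_comm, pairing_X_mul_orthoPoly_succ hα, normSq_succ hα]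
  cases n with
  | zero => simp [beta]
  | succ m =>
    rw [Nat.add_sub_cancel, ← pairing_X_mul, pairing_X_mul_orthoPoly_succ hα]
    ring

/-- The Toda-type (Volterra) equation `β_n' = β_n (β_{n-1} - β_{n+1})`. -/
theorem hasDerivAt_beta {α : ℝ} (hα : -1 < α) (n : ℕ) (t : ℝ) :
    HasDerivAt (beta α n) (beta α n t * (beta α (n - 1) t - beta α (n + 1) t)) t := by
  cases n with
  | zero =>
    have e : beta α 0 = fun _ => 0 := rfl
    rw [e]
    simpa using hasDerivAt_const t (0 : ℝ)
  | succ m =>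
    have h := (hasDerivAt_normSq hα (m + 1) t).div (hasDerivAt_normSq hα m t)
      (normSq_pos hα m t).ne'
    rw [pairing_X_sq_mul_orthoPoly_self hα, pairing_X_sq_mul_orthoPoly_self hα] at h
    refine HasDerivAt.congr_deriv (f := beta α (m + 1)) h ?_
    have h0 := (normSq_pos hα m t).ne'
    rw [Nat.add_sub_cancel, div_eq_iff (pow_ne_zero 2 h0), normSq_succ hα m t]
    ring

/-- Bootstrapping: the Volterra equation expresses `β_n'` polynomially through the `β_k`. -/
theorem contDiff_beta {α : ℝ} (hα : -1 < α) (k n : ℕ) : ContDiff ℝ k (beta α n) := by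
  induction k generalizing n with
  | zero =>
    exact contDiff_zero.2 (continuous_iff_continuousAt.2 fun t =>
      (hasDerivAt_beta hα n t).continuousAt)
  | succ k ih =>
    have hd : deriv (beta α n) =
        fun t => beta α n t * (beta α (n - 1) t - beta α (n + 1) t) :=
      funext fun t => (hasDerivAt_beta hα n t).deriv
    push_cast
    refine contDiff_succ_iff_deriv.2 ⟨fun t => (hasDerivAt_beta hα n t).differentiableAt,
      by simp, ?_⟩
    rw [hd]
    exact (ih n).mul ((ih (n - 1)).sub (ih (n + 1)))

/-! ### The structure relation and its values at the endpoint -/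

/-- Integration by parts against `(1 - x²) w`, whose derivative is
`(-2 (1 + α + t) x + 2 t x³) w`. The boundary terms vanish because `α + 1 > 0`. -/
theorem pairing_integral_by_parts {α : ℝ} (hα : -1 < α) (t : ℝ) (p q : ℝ[X]) :
    pairing α t ((1 - X ^ 2) * derivative p) q + pairing α t p ((1 - X ^ 2) * derivative q) =
      2 * (1 + α + t) * pairing α t p (X * q) - 2 * t * pairing α t p (X ^ 3 * q) := by
  set f : ℝ[X] := (1 - X ^ 2) * derivative p * q + p * ((1 - X ^ 2) * derivative q) -
    C (2 * (1 + α + t)) * (p * (X * q)) + C (2 * t) * (p * (X ^ 3 * q)) with hf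
  have hFTC : pairing α t f 1 = 0 := by
    have h := intervalIntegral.integral_eq_sub_of_hasDerivAt_of_le (a := -1) (b := 1)
      (f := fun x => (1 - x ^ 2) ^ (α + 1) * (p.eval x * q.eval x * Real.exp (-t * x ^ 2)))
      (f' := fun x => f.eval x * (1 : ℝ[X]).eval x * weight α t x) (by norm_num) ?_ ?_
      (pairing_intervalIntegrable hα t f 1)
    · rw [pairing, h]
      simp [Real.zero_rpow (by linarith : α + 1 ≠ 0)]
    · refine Continuous.continuousOn (Continuous.mul ?_ (by fun_prop))
      exact Continuous.rpow_const (by fun_prop) fun x => Or.inr (by linarith)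
    · intro x hx
      have h0 : 0 < 1 - x ^ 2 := by nlinarith [hx.1, hx.2]
      have h1 : HasDerivAt (fun x : ℝ => 1 - x ^ 2) (-(2 * x)) x := by
        simpa using (hasDerivAt_pow 2 x).const_sub 1
      have h2 := h1.rpow_const (p := α + 1) (Or.inl h0.ne')
      have h3 : HasDerivAt (fun x : ℝ => -t * x ^ 2) (-t * (2 * x)) x := by
        simpa using (hasDerivAt_pow 2 x).const_mul (-t)
      refine (h2.mul (((p.hasDerivAt x).mul (q.hasDerivAt x)).mul h3.exp)).congr_deriv ?_
      rw [add_sub_cancel_right, Real.rpow_add_one h0.ne', hf]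
      simp only [weight, Pi.mul_apply, eval_mul, eval_pow, eval_X, eval_sub, eval_one, eval_add,
        eval_C]
      ring
  have hone : ∀ r s : ℝ[X], pairing α t (r * s) 1 = pairing α t r s := by
    intro r s
    simp [pairing]
  rw [hf, pairing_add_left hα, pairing_sub_left hα, pairing_add_left hα, pairing_C_mul_left,
    pairing_C_mul_left, hone, hone, hone, hone] at hFTC
  linarith

theorem pairing_orthoPoly_eq_zero_of_parity (α t : ℝ) {q : ℝ[X]} {n : ℕ}
    (hq : q.comp (-X) = C ((-1) ^ (n + 1)) * q) : pairing α t q (orthoPoly α t n) = 0 := by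
  have h := pairing_comp_neg α t q (orthoPoly α t n)
  rw [hq, orthoPoly_comp_neg, pairing_C_mul_left, pairing_C_mul_right, ← mul_assoc, ← pow_add,
    Odd.neg_one_pow ⟨n, by ring⟩] at h
  linarith

theorem natDegree_one_sub_X_sq_mul_derivative_le {p : ℝ[X]} {n : ℕ} (hp : p.natDegree ≤ n) :
    ((1 - X ^ 2) * derivative p).natDegree ≤ n + 1 := by
  rw [natDegree_le_iff_coeff_eq_zero]
  intro m hm
  obtain ⟨k, rfl⟩ : ∃ k, m = k + 2 := ⟨m - 2, by omega⟩
  rw [sub_mul, one_mul, coeff_sub, coeff_X_pow_mul, coeff_derivative, coeff_derivative,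
    coeff_eq_zero_of_natDegree_lt (by omega), coeff_eq_zero_of_natDegree_lt (by omega)]
  simp

theorem coeff_one_sub_X_sq_mul_derivative_orthoPoly (α t : ℝ) (n : ℕ) :
    ((1 - X ^ 2) * derivative (orthoPoly α t n)).coeff (n + 1) = -(n : ℝ) := by
  have hd := (orthoPoly_natDegree α t n).le
  rw [sub_mul, one_mul, coeff_sub, coeff_derivative, coeff_eq_zero_of_natDegree_lt (by omega)]
  cases n with
  | zero =>
    rw [coeff_X_pow_mul']
    simp
  | succ k =>
    rw [coeff_X_pow_mul, coeff_derivative, coeff_orthoPoly_self]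
    push_cast
    ring

theorem comp_neg_derivative_orthoPoly (α t : ℝ) (n : ℕ) :
    (derivative (orthoPoly α t n)).comp (-X) =
      C ((-1) ^ (n + 1)) * derivative (orthoPoly α t n) := by
  have h := congrArg derivative (orthoPoly_comp_neg α t n)
  rw [derivative_comp, derivative_C_mul, derivative_neg, derivative_X] at h
  rw [pow_succ, C_mul, C_neg, C_1]
  linear_combination -h

/-- The lowering relation
`(1 - x²) P_n' = (2 t β_n - n) x P_n + β_n (R_n + 2 t (1 - x²)) P_{n-1}`.
The difference of the two sides has degree at most `n + 1`, and it is orthogonal to `P_k` for every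
`k ≤ n + 1`: for `k = n + 1` by its top coefficient, for `k = n` by parity, and for `k < n` through
integration by parts. The value of `R_n` is exactly what the case `k = n - 1` requires. -/
theorem structure_relation {α : ℝ} (hα : -1 < α) (t : ℝ) (n : ℕ) :
    (1 - X ^ 2) * derivative (orthoPoly α t n) =
      C (2 * t * beta α n t - n) * (X * orthoPoly α t n) +
        C (beta α n t * (R α n t + 2 * t)) * orthoPoly α t (n - 1) -
          C (2 * t * beta α n t) * (X ^ 2 * orthoPoly α t (n - 1)) := by
  cases n with
  | zero =>
    have h1 : orthoPoly α t 0 = 1 := by rw [orthoPoly]; simp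
    simp [h1, beta]
  | succ m =>
    rw [Nat.add_sub_cancel, ← sub_eq_zero]
    set P := orthoPoly α t (m + 1) with hP
    set Q := orthoPoly α t m with hQ
    set b := beta α (m + 1) t with hb
    set D : ℝ[X] := (1 - X ^ 2) * derivative P - (C (2 * t * b - (m + 1 : ℕ)) * (X * P) +
      C (b * (R α (m + 1) t + 2 * t)) * Q - C (2 * t * b) * (X ^ 2 * Q)) with hD
    have dP : P.natDegree = m + 1 := orthoPoly_natDegree α t (m + 1)
    have dQ : Q.natDegree = m := orthoPoly_natDegree α t m
    have hXP : (X * P).natDegree ≤ m + 2 := natDegree_X_mul_orthoPoly_le α t (m + 1)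
    have hXXQ : (X ^ 2 * Q).natDegree ≤ m + 2 := natDegree_X_pow_mul_orthoPoly_le α t 2 m
    have hdP : ((1 - X ^ 2) * derivative P).natDegree ≤ m + 2 :=
      natDegree_one_sub_X_sq_mul_derivative_le dP.le
    have hdeg : D.natDegree ≤ m + 2 := by
      refine (natDegree_sub_le _ _).trans (max_le hdP ((natDegree_sub_le _ _).trans (max_le ?_ ?_)))
      · refine (natDegree_add_le _ _).trans (max_le ?_ ?_)
        · exact (natDegree_C_mul_le _ _).trans hXP
        · exact (natDegree_C_mul_le _ _).trans (by omega)
      · exact (natDegree_C_mul_le _ _).trans hXXQ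
    -- Integration by parts moves the derivative in `⟨D, g⟩` to the test polynomial `g`; the terms
    -- `⟨x² Q, g⟩` cancel after expanding `⟨P, x³ g⟩ = ⟨x P, x² g⟩` by the recurrence.
    have hpair : ∀ g, pairing α t D g = -pairing α t ((1 - X ^ 2) * derivative g) P +
        (2 * (1 + α + t) + (m + 1) - 2 * t * b) * pairing α t (X * g) P -
        2 * t * pairing α t (X ^ 2 * g) (orthoPoly α t (m + 2)) -
        b * (R α (m + 1) t + 2 * t) * pairing α t g Q := by
      intro g
      have h1 := pairing_integral_by_parts hα t P g
      have h3 : pairing α t P (X ^ 3 * g) = pairing α t (X ^ 2 * g) (orthoPoly α t (m + 2)) +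
          b * pairing α t (X ^ 2 * Q) g := by
        rw [pow_succ' X 2, mul_assoc, ← pairing_X_mul, X_mul_orthoPoly hα, pairing_add_left hα,
          pairing_C_mul_left, pairing_X_pow_mul α t 2 Q, Nat.add_sub_cancel, pairing_comm]
      have h4 : pairing α t (X * P) g = pairing α t P (X * g) := pairing_X_mul _ _ _ _
      rw [hD, pairing_sub_left hα, pairing_sub_left hα, pairing_add_left hα, pairing_C_mul_left,
        pairing_C_mul_left, pairing_C_mul_left, h4, pairing_comm α t (X * g),
        pairing_comm α t g, pairing_comm α t _ P]
      push_cast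
      linear_combination h1 - 2 * t * h3
    refine eq_zero_of_pairing_orthoPoly hα t fun k hk => ?_
    have hk := hk.trans hdeg
    have dk := orthoPoly_natDegree α t k
    have dXk : (X * orthoPoly α t k).natDegree ≤ k + 1 := natDegree_X_mul_orthoPoly_le α t k
    have dXXk : (X ^ 2 * orthoPoly α t k).natDegree ≤ k + 2 :=
      natDegree_X_pow_mul_orthoPoly_le α t 2 k
    have dDk := natDegree_one_sub_X_sq_mul_derivative_le dk.le
    obtain rfl | rfl | rfl | hlt : k = m + 2 ∨ k = m + 1 ∨ k = m ∨ k < m := by omega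
    · rw [pairing_orthoPoly_of_natDegree_le hα t D hdeg, hD]
      simp only [coeff_sub, coeff_add, coeff_C_mul]
      rw [coeff_one_sub_X_sq_mul_derivative_orthoPoly, coeff_X_pow_mul, coeff_X_mul,
        coeff_eq_zero_of_natDegree_lt (p := Q) (by omega), hP, hQ, coeff_orthoPoly_self,
        coeff_orthoPoly_self]
      ring
    · refine pairing_orthoPoly_eq_zero_of_parity α t ?_
      rw [hD]
      simp only [sub_comp, add_comp, mul_comp, C_comp, X_comp, one_comp, X_pow_comp]
      rw [comp_neg_derivative_orthoPoly, orthoPoly_comp_neg, orthoPoly_comp_neg]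
      simp only [pow_succ, C_mul, C_neg, C_1]
      ring
    · have e1 := pairing_orthoPoly_of_natDegree_le hα t _ dDk
      have e2 := pairing_X_mul_orthoPoly_succ hα t k
      have e3 := pairing_orthoPoly_of_natDegree_le hα t _ dXXk
      rw [coeff_one_sub_X_sq_mul_derivative_orthoPoly] at e1
      rw [coeff_X_pow_mul, coeff_orthoPoly_self, one_mul, normSq_succ hα] at e3
      have e4 : pairing α t Q Q = normSq α k t := rfl
      rw [hpair, e1, e2, e3, e4, normSq_succ hα k, R, ← hb]
      push_cast
      ring
    · have z : ∀ {q : ℝ[X]} {n : ℕ}, q.natDegree < n → pairing α t q (orthoPoly α t n) = 0 := by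
        intro q n hq
        rw [pairing_orthoPoly_of_natDegree_le hα t q hq.le, coeff_eq_zero_of_natDegree_lt hq,
          zero_mul]
      rw [hpair, hP, hQ, z (by omega), z (by omega), z (by omega), z (by omega)]
      ring

theorem eval_one_orthoPoly {α : ℝ} (hα : -1 < α) (t : ℝ) (n : ℕ) :
    (orthoPoly α t n).eval 1 =
      (orthoPoly α t (n + 1)).eval 1 + beta α n t * (orthoPoly α t (n - 1)).eval 1 := by
  simpa using congrArg (eval 1) (X_mul_orthoPoly hα t n)

/-- Two consecutive values `P_n(1)`, `P_{n+1}(1)` cannot both vanish, as the recurrence would carry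
the zeros down to `P_0 = 1`. -/
theorem eval_one_orthoPoly_ne_zero_or {α : ℝ} (hα : -1 < α) (t : ℝ) (n : ℕ) :
    (orthoPoly α t n).eval 1 ≠ 0 ∨ (orthoPoly α t (n + 1)).eval 1 ≠ 0 := by
  induction n with
  | zero =>
    left
    rw [orthoPoly]
    simp
  | succ n ih =>
    by_contra! h
    have h1 := eval_one_orthoPoly hα t (n + 1)
    rw [h.1, h.2, Nat.add_sub_cancel, zero_add, eq_comm, mul_eq_zero,
      or_iff_right (beta_succ_pos hα n t).ne'] at h1
    exact ih.elim (absurd h1) (absurd h.1)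

/-- The structure relation at the zero `x = 1` of `1 - x²`. -/
theorem endpoint_relation {α : ℝ} (hα : -1 < α) (t : ℝ) (n : ℕ) :
    (n - 2 * t * beta α n t) * (orthoPoly α t n).eval 1 =
      beta α n t * R α n t * (orthoPoly α t (n - 1)).eval 1 := by
  have h := congrArg (eval 1) (structure_relation hα t n)
  simp only [eval_mul, eval_sub, eval_add, eval_one, eval_pow, eval_X, eval_C] at h
  linear_combination h

/-- The quadratic relation `β_n R_n R_{n-1} = (n - 2tβ_n) (n + 2α - 2tβ_n)`. The structure relations
for `n` and `n - 1` at `x = 1` are two linear equations for `(P_n(1), P_{n-1}(1))`, a nonzero vector,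
so their determinant vanishes. -/
theorem beta_mul_R_mul_R {α : ℝ} (hα : -1 < α) (t : ℝ) (n : ℕ) :
    beta α n t * R α n t * R α (n - 1) t =
      (n - 2 * t * beta α n t) * (n + 2 * α - 2 * t * beta α n t) := by
  cases n with
  | zero => simp [beta]
  | succ m =>
    have h1 := endpoint_relation hα t (m + 1)
    rw [Nat.add_sub_cancel] at h1 ⊢
    -- the relation for `m`, with `P_{m-1}(1)` replaced by means of the recurrence
    have h2 : R α m t * (orthoPoly α t (m + 1)).eval 1 =
        ((m + 1 : ℕ) + 2 * α - 2 * t * beta α (m + 1) t) * (orthoPoly α t m).eval 1 := by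
      have h3 := endpoint_relation hα t m
      have h4 := eval_one_orthoPoly hα t m
      have h5 : R α m t = 2 * m + 1 + 2 * α - 2 * t * (beta α m t + beta α (m + 1) t) := rfl
      push_cast
      linear_combination h3 - R α m t * h4 + (orthoPoly α t m).eval 1 * h5
    rcases eval_one_orthoPoly_ne_zero_or hα t m with h | h
    · refine mul_right_cancel₀ h ?_
      linear_combination -R α m t * h1 + ((m + 1 : ℕ) - 2 * t * beta α (m + 1) t) * h2
    · refine mul_right_cancel₀ h ?_
      linear_combination beta α (m + 1) t * R α (m + 1) t * h2 -
        ((m + 1 : ℕ) + 2 * α - 2 * t * beta α (m + 1) t) * h1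

/-! ### The Painlevé equation -/

/-- The quadratic relation with `R_{n-1}` written out. Unlike `R α (n - 1) t`, the third factor here
also has the right meaning at `n = 0`, where `n - 1` is truncated. -/
theorem beta_mul_R_mul_expanded {α : ℝ} (hα : -1 < α) (t : ℝ) (n : ℕ) :
    beta α n t * R α n t * (2 * n - 1 + 2 * α - 2 * t * (beta α (n - 1) t + beta α n t)) =
      (n - 2 * t * beta α n t) * (n + 2 * α - 2 * t * beta α n t) := by
  rw [← beta_mul_R_mul_R hα]
  cases n with
  | zero => simp [beta]
  | succ m =>
    rw [R, R, Nat.add_sub_cancel]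
    push_cast
    ring

theorem contDiff_R {α : ℝ} (hα : -1 < α) (k n : ℕ) : ContDiff ℝ k (R α n) := by
  have h1 := contDiff_beta hα k n
  have h2 := contDiff_beta hα k (n + 1)
  unfold R
  fun_prop

/-- The first-order equation
`t R_n' = -2tβ_n (R_n + 2t) + R_n (2n + 1 + 2α - R_n) / 2 - t R_n + 2t (n + α)`. The neighbours
`β_{n-1}` and `β_{n+2}` in the Volterra equations are eliminated by the quadratic relations for `n`
and `n + 1`. -/
theorem hasDerivAt_R {α : ℝ} (hα : -1 < α) (n : ℕ) {t : ℝ} (ht : t ≠ 0) (hR : R α n t ≠ 0) :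
    HasDerivAt (R α n) ((-(2 * t * beta α n t) * (R α n t + 2 * t) +
      R α n t * (2 * n + 1 + 2 * α - R α n t) / 2 - t * R α n t + 2 * t * (n + α)) / t) t := by
  have h1 := ((hasDerivAt_id t).const_mul 2).mul
    ((hasDerivAt_beta hα n t).add (hasDerivAt_beta hα (n + 1) t))
  refine HasDerivAt.congr_deriv (f := R α n) (h1.const_sub (2 * n + 1 + 2 * α)) ?_
  have e1 := beta_mul_R_mul_expanded hα t n
  have e2 := beta_mul_R_mul_expanded hα t (n + 1)
  have e3 : R α (n + 1) t =
      2 * n + 3 + 2 * α - 2 * t * (beta α (n + 1) t + beta α (n + 2) t) := by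
    rw [R]
    push_cast
    ring
  have e4 : 2 * ((n + 1 : ℕ) : ℝ) - 1 + 2 * α - 2 * t * (beta α n t + beta α (n + 1) t) =
      R α n t := by
    rw [R]
    push_cast
    ring
  rw [Nat.add_sub_cancel, e4, e3] at e2
  rw [eq_div_iff ht]
  refine mul_right_cancel₀ hR ?_
  simp only [id, Pi.add_apply, Nat.add_sub_cancel]
  rw [R] at *
  push_cast at *
  linear_combination t * e1 - t * e2

/-- The companion of the equation for `R_n`, for the shifted unknown `u = 2tβ_n - n - α`. The shift
makes the quadratic relation even: `(n - 2tβ_n) (n + 2α - 2tβ_n) = u² - α²`. -/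
theorem hasDerivAt_two_mul_t_mul_beta {α : ℝ} (hα : -1 < α) (n : ℕ) {t : ℝ} (ht : t ≠ 0)
    (hR : R α n t ≠ 0) :
    HasDerivAt (fun s => 2 * s * beta α n s - n - α) ((t * beta α n t * R α n t -
      t * ((n - 2 * t * beta α n t) * (n + 2 * α - 2 * t * beta α n t)) / R α n t) / t) t := by
  have h1 := ((((hasDerivAt_id t).const_mul 2).mul (hasDerivAt_beta hα n t)).sub_const
    (n : ℝ)).sub_const α
  refine h1.congr_deriv ?_
  have e1 := beta_mul_R_mul_expanded hα t n
  rw [← e1]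
  simp only [id]
  field_simp
  rw [R]
  ring

/-- In terms of `u = 2tβ_n - n - α`, the equation for `R_n` becomes
`t W_n' = (W_n - 1) (1/2 + W_n u) + t W_n`. -/
theorem hasDerivAt_W {α : ℝ} (hα : -1 < α) (n : ℕ) {t : ℝ} (ht : t ≠ 0) (hR : R α n t ≠ 0) :
    HasDerivAt (W α n) (((W α n t - 1) * (1 / 2 + W α n t * (2 * t * beta α n t - n - α)) +
      t * W α n t) / t) t := by
  have h1 := (((hasDerivAt_id t).const_mul 2).div (hasDerivAt_R hα n ht hR) hR).const_add 1
  refine HasDerivAt.congr_deriv (f := W α n) h1 ?_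
  simp only [W, id]
  field_simp
  ring

/-- Eliminating `u` from the system
`t W' = (W - 1) (1/2 + W u) + t W`, `t u' = (u + n + a) t / (W - 1) - (W - 1) (u² - a²) / 2`
gives Painlevé V: the left-hand side is the derivative of the expression for `W'` by the quotient
rule. -/
theorem painleveV_identity (W u t n a W' u' : ℝ) (ht : t ≠ 0) (hW : W ≠ 0) (hW1 : W - 1 ≠ 0)
    (h1 : W' = ((W - 1) * (1 / 2 + W * u) + t * W) / t)
    (h2 : u' = ((u + n + a) * t / (W - 1) - (W - 1) / 2 * (u ^ 2 - a ^ 2)) / t) :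
    ((W' * (1 / 2 + W * u) + (W - 1) * (W' * u + W * u') + (W + t * W')) * t -
        ((W - 1) * (1 / 2 + W * u) + t * W)) / t ^ 2 =
      (3 * W - 1) * W' ^ 2 / (2 * W * (W - 1)) - W' / t
        + (W - 1) ^ 2 / t ^ 2 * (a ^ 2 / 2 * W + (-1 / 8) / W)
        + (2 * n + 1 + 2 * a) / 2 * W / t + (-1 / 2) * W * (W + 1) / (W - 1) := by
  rw [h1, h2]
  field_simp
  ring

theorem painleveVAt_W {α : ℝ} (hα : -1 < α) (n : ℕ) {t : ℝ} (ht : t ≠ 0) (hR : R α n t ≠ 0)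
    (hW : W α n t ≠ 0) :
    PainleveVAt (α ^ 2 / 2) (-1 / 8) ((2 * n + 1 + 2 * α) / 2) (-1 / 2) (W α n) t := by
  constructor
  · have h := (contDiff_R hα 2 n).contDiffAt (x := t)
    exact contDiffAt_const.add ((contDiffAt_const.mul contDiffAt_id).div h hR)
  have hW1 : W α n t - 1 ≠ 0 := by
    rw [W, add_sub_cancel_left]
    exact div_ne_zero (mul_ne_zero two_ne_zero ht) hR
  have hev : deriv (W α n) =ᶠ[nhds t] fun s =>
      ((W α n s - 1) * (1 / 2 + W α n s * (2 * s * beta α n s - n - α)) + s * W α n s) / s := by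
    filter_upwards [eventually_ne_nhds ht,
      (contDiff_R hα 0 n).continuous.continuousAt.eventually_ne hR] with s hs hRs
    exact (hasDerivAt_W hα n hs hRs).deriv
  have hdW := hasDerivAt_W hα n ht hR
  have hdu := hasDerivAt_two_mul_t_mul_beta hα n ht hR
  have hd := (((hdW.sub_const 1).mul ((hdW.mul hdu).const_add (1 / 2))).add
    ((hasDerivAt_id t).mul hdW)).div (hasDerivAt_id t) ht
  have hd2 : deriv (deriv (W α n)) t = _ := hev.deriv_eq.trans hd.deriv
  have key := painleveV_identity (W α n t) (2 * t * beta α n t - n - α) t n α _ ht hW hW1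
    hdW.deriv ?_ (u' := (t * beta α n t * R α n t -
      t * ((n - 2 * t * beta α n t) * (n + 2 * α - 2 * t * beta α n t)) / R α n t) / t)
  · rw [← key, hd2, hdW.deriv]
    simp only [id, Pi.mul_apply, Pi.add_apply]
    ring
  · have e : R α n t = 2 * t / (W α n t - 1) := by
      rw [W, add_sub_cancel_left]
      field_simp
    rw [e]
    field_simp
    ring

theorem hasDerivAt_W_zero {α : ℝ} (hα : -1 < α) (n : ℕ) (hn : (2 * n + 1 + 2 * α : ℝ) ≠ 0) :
    HasDerivAt (W α n) (2 / (2 * n + 1 + 2 * α)) 0 := by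
  have hR0 : R α n 0 = 2 * n + 1 + 2 * α := by simp [R]
  have hd := ((contDiff_R hα 1 n).differentiable (by simp) 0).hasDerivAt
  have h1 := (((hasDerivAt_id (0 : ℝ)).const_mul 2).div hd (hR0 ▸ hn)).const_add 1
  refine HasDerivAt.congr_deriv (f := W α n) h1 ?_
  rw [hR0]
  simp only [id]
  field_simp
  ring

end SemiclassicalJacobi

theorem mainTheorem1 (α : ℝ) (hα : -1 < α) (n : ℕ) :
    (∀ t : ℝ, t ≠ 0 → SemiclassicalJacobi.R α n t ≠ 0 → SemiclassicalJacobi.W α n t ≠ 0 →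
      SemiclassicalJacobi.PainleveVAt (α ^ 2 / 2) (-1 / 8) ((2 * n + 1 + 2 * α) / 2) (-1 / 2)
        (SemiclassicalJacobi.W α n) t) ∧
    ((2 * n + 1 + 2 * α : ℝ) ≠ 0 →
      SemiclassicalJacobi.W α n 0 = 1 ∧
      HasDerivAt (SemiclassicalJacobi.W α n) (2 / (2 * n + 1 + 2 * α)) 0) :=
  ⟨fun _ ht hR hW => SemiclassicalJacobi.painleveVAt_W hα n ht hR hW, fun hn =>
    ⟨by simp [SemiclassicalJacobi.W], SemiclassicalJacobi.hasDerivAt_W_zero hα n hn⟩⟩
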